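/- **Setting.** Let $n,m\ge 1$ and let $b_1,\dots,b_m$ be real functions that are positive and non-decreasing on $\{1,\dots,n\}$ and convex there in the discrete sense, i.e. $b_j(x+1)-b_j(x)$ is non-decreasing (more generally, for each $j$ it suffices that $x\mapsto b_j(x)x$ is convex in this sense). Let $\mathcal L=\{\sum_{j=1}^m\alpha_jb_j:\alpha_j\ge 0\}$ and let $\mathcal G$ be the class of congestion games with at most $n$ agents, a finite set of resources $\mathcal E$, resource costs $\ell_e\in\mathcal L$, and a nonempty set $\mathcal A_i\subseteq 2^{\mathcal E}$ of actions for each agent $i$. In an allocation $a=(a_i)_i$, $a_i\in\mathcal A_i$, let $|a|_e$ be the number of agents using $e$. The system cost is $\mathrm{SC}(a)=\sum_i\sum_{e\in a_i}\ell_e(|a|_e)$. A congestion-independent local toll is a map $T:\mathcal L\to\mathbb R_{\ge 0}$; under $T$ agent $i$ incurs the cost $\sum_{e\in a_i}[\ell_e(|a|_e)+T(\ell_e)]$. The price of anarchy $\mathrm{PoA}(T)\in[0,\infty]$ (for pure Nash, resp. coarse correlated, equilibria) is the supremum over $G\in\mathcal G$ of the highest (expected) system cost at an equilibrium of $G$ under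 $T$ divided by the minimum system cost of $G$ (with $0/0=0$ and $c/0=\infty$ for $c>0$). Consider the linear program of maximizing $\rho$ over $\rho\in\mathbb R$, $\nu\in[0,1]$ subject to, for all $j\in\{1,\dots,m\}$ and all $u,v\in\{0,\dots,n\}$ with $u\ge v$, $$b_j(v)v-\rho\, b_j(u)u+\nu[b_j(u)u-b_j(u+1)v]+b_j(1)(1-\nu)(u-v)\ge 0\quad\text{if }u+v\le n,$$ $$b_j(v)v-\rho\, b_j(u)u+\nu[b_j(u)(n-v)-b_j(u+1)(n-u)]+b_j(1)(1-\nu)(u-v)\ge 0\quad\text{if }u+v>n,$$ where $b_j(0)=b_j(n+1)=0$. **Theorem.** The program has an optimal solution $(\rho^*,\nu^*)$ with $\nu^*>0$, and every optimal solution has $\nu^*>0$ unless all $b_j$ are constant on $\{1,\dots,n\}$. For every optimal solution $(\rho^*,\nu^*)$ with $\nu^*>0$ one has $\rho^*>0$, and $$T^*\Big(\sum_{j=1}^m\alpha_jb_j\Big)=\sum_{j=1}^m\alpha_j\tau_j^*,\qquad \tau^*_j=\Big(\frac1{\nu^*}-1\Big)b_j(1)\ge 0,$$ is a well-defined, non-negative,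 congestion-independent local toll. It minimizes the price of anarchy over all (linear or non-linear) non-negative congestion-independent local tolls, and $\mathrm{PoA}(T^*)=1/\rho^*$. Both statements hold for pure Nash equilibria and for coarse correlated equilibria. -/

import Mathlib

/-- A congestion game with at most `n` agents whose resource costs belong to the class `L`.
The agents are `0, …, numAgents - 1`; every agent has a nonempty list of feasible sets of
resources. -/
structure CongestionGame (n : ℕ) (L : Set (ℕ → ℝ)) where
  numAgents : ℕ
  numAgents_le : numAgents ≤ n
  Resource : Type
  [fintypeResource : Fintype Resource]
  [decEqResource : DecidableEq Resource]
  cost : Resource → ℕ → ℝ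
  cost_mem : ∀ e, cost e ∈ L
  actions : Fin numAgents → Finset (Finset Resource)
  actions_nonempty : ∀ i, (actions i).Nonempty

attribute [instance] CongestionGame.fintypeResource CongestionGame.decEqResource

/-- A local tolling mechanism: the toll on a resource depends only on the cost function `ℓ` of
that resource, and `T ℓ x` is the toll levied when `x` agents use the resource. -/
abbrev LocalMechanism : Type := (ℕ → ℝ) → ℕ → ℝ

/-- The congestion-independent local mechanism that levies the constant toll `t ℓ` on every
resource with cost function `ℓ`. -/
def congestionIndependent (t : (ℕ → ℝ) → ℝ) : LocalMechanism := fun ℓ _ => t ℓ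

namespace CongestionGame

variable {n : ℕ} {L : Set (ℕ → ℝ)} (G : CongestionGame n L)

/-- Allocations: every agent chooses one of her feasible sets of resources. -/
abbrev Allocation : Type := (i : Fin G.numAgents) → {A : Finset G.Resource // A ∈ G.actions i}

/-- The number of agents using the resource `e`. -/
def load (a : G.Allocation) (e : G.Resource) : ℕ :=
  (Finset.univ.filter fun i => e ∈ (a i).1).card

/-- The system cost; tolls do not enter. -/
def systemCost (a : G.Allocation) : ℝ :=
  ∑ i, ∑ e ∈ (a i).1, G.cost e (G.load a e)

/-- The cost incurred by agent `i`: the costs and the tolls of all the resources she uses. -/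
def agentCost (T : LocalMechanism) (a : G.Allocation) (i : Fin G.numAgents) : ℝ :=
  ∑ e ∈ (a i).1, (G.cost e (G.load a e) + T (G.cost e) (G.load a e))

/-- Pure Nash equilibria of the tolled game. -/
def IsPureNash (T : LocalMechanism) (a : G.Allocation) : Prop :=
  ∀ (i : Fin G.numAgents) (A : {A : Finset G.Resource // A ∈ G.actions i}),
    G.agentCost T a i ≤ G.agentCost T (Function.update a i A) i

/-- Coarse correlated equilibria of the tolled game: probability distributions `p` over the
allocations such that no agent gains in expectation by committing to a fixed action. -/
def IsCoarseCorrelated (T : LocalMechanism) (p : G.Allocation → ℝ) : Prop :=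
  p ∈ stdSimplex ℝ G.Allocation ∧
    ∀ (i : Fin G.numAgents) (A : {A : Finset G.Resource // A ∈ G.actions i}),
      ∑ a, p a * G.agentCost T a i ≤ ∑ a, p a * G.agentCost T (Function.update a i A) i

/-- The minimum system cost. -/
noncomputable def minCost : ENNReal :=
  ⨅ a : G.Allocation, ENNReal.ofReal (G.systemCost a)

/-- The highest system cost at a pure Nash equilibrium. -/
noncomputable def nashCost (T : LocalMechanism) : ENNReal :=
  ⨆ (a : G.Allocation) (_ : G.IsPureNash T a), ENNReal.ofReal (G.systemCost a)

/-- The highest expected system cost at a coarse correlated equilibrium. -/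
noncomputable def coarseCost (T : LocalMechanism) : ENNReal :=
  ⨆ (p : G.Allocation → ℝ) (_ : G.IsCoarseCorrelated T p),
    ENNReal.ofReal (∑ a, p a * G.systemCost a)

end CongestionGame

/-- The price of anarchy of `T` for pure Nash equilibria, over all congestion games with at most
`n` agents and resource costs in `L`. In `[0, ∞]` one has `c / 0 = ∞` for `c > 0`, and
`0 / 0 = 0`, so that games in which all the costs involved vanish do not count. -/
noncomputable def pureNashPoA (n : ℕ) (L : Set (ℕ → ℝ)) (T : LocalMechanism) : ENNReal :=
  ⨆ G : CongestionGame n L, G.nashCost T / G.minCost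

/-- The price of anarchy of `T` for coarse correlated equilibria. -/
noncomputable def coarsePoA (n : ℕ) (L : Set (ℕ → ℝ)) (T : LocalMechanism) : ENNReal :=
  ⨆ G : CongestionGame n L, G.coarseCost T / G.minCost

/-- The resource costs `∑ j, α j * b j` with `α j ≥ 0`. -/
def costClass {m : ℕ} (b : Fin m → ℕ → ℝ) : Set (ℕ → ℝ) :=
  {ℓ | ∃ α : Fin m → ℝ, (∀ j, 0 ≤ α j) ∧ ℓ = fun x => ∑ j, α j * b j x}

/-- Convexity in the discrete sense on `{1, …, n}`: the increments are non-decreasing. -/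
def DiscreteConvex (n : ℕ) (f : ℕ → ℝ) : Prop :=
  ∀ x, 1 ≤ x → x + 2 ≤ n → f (x + 1) - f x ≤ f (x + 2) - f (x + 1)

/-- The restriction of `f` to `{1, …, n}`, with the convention that it vanishes at all other
points (only `0` and `n + 1` are ever used). -/
def zeroExtend (n : ℕ) (f : ℕ → ℝ) (x : ℕ) : ℝ :=
  if 1 ≤ x ∧ x ≤ n then f x else 0

/-- The feasible points `(ρ, ν)` of the linear program. -/
def LPFeasible (n : ℕ) {m : ℕ} (b : Fin m → ℕ → ℝ) (ρ ν : ℝ) : Prop :=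
  0 ≤ ν ∧ ν ≤ 1 ∧
  (∀ (j : Fin m) (u v : ℕ), u ≤ n → v ≤ n → u + v ≤ n → v ≤ u →
    0 ≤ zeroExtend n (b j) v * v - ρ * zeroExtend n (b j) u * u
      + ν * (zeroExtend n (b j) u * u - zeroExtend n (b j) (u + 1) * v)
      + b j 1 * (1 - ν) * ((u : ℝ) - v)) ∧
  (∀ (j : Fin m) (u v : ℕ), u ≤ n → v ≤ n → n < u + v → v ≤ u →
    0 ≤ zeroExtend n (b j) v * v - ρ * zeroExtend n (b j) u * u
      + ν * (zeroExtend n (b j) u * ((n : ℝ) - v)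
        - zeroExtend n (b j) (u + 1) * ((n : ℝ) - u))
      + b j 1 * (1 - ν) * ((u : ℝ) - v))

/-- `(ρ, ν)` solves the linear program: it is feasible and maximizes `ρ`. -/
def LPOptimal (n : ℕ) {m : ℕ} (b : Fin m → ℕ → ℝ) (ρ ν : ℝ) : Prop :=
  LPFeasible n b ρ ν ∧ ∀ ρ' ν', LPFeasible n b ρ' ν' → ρ' ≤ ρ

/-! On a resource with cost `b j`, equilibrium load `u` and optimal load `v`, an LP constraint
reads: optimal cost − `ρ` · equilibrium cost + `ν` · (gain in tolled cost when agents deviate to the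
optimum) ≥ 0. The toll `τ j = (1/ν - 1) * b j 1` contributes `ν * τ j * (u - v) = b j 1 * (1 - ν) *
(u - v)`.

Upper bound (`LPFeasible.basis_smooth`, `LPFeasible.coarsePoA_le`): the smallest overlap of the two
user sets is the worst one, and the pairs `v > u` follow from monotonicity, so the inequality holds
for all loads and overlaps. Summed over resources it is a smoothness inequality. The total gain is
non-positive in expectation at a coarse correlated equilibrium, so the ratio is at most `1/ρ`.

Lower bound (`LPOptimal.ofReal_le_pureNashPoA_of_lt`): fix arbitrary tolls and `r > ρ`. A multiplier
`ν` satisfying all constraints with these tolls in place of `τ` would, by the case `u = 0`, `v = 1`,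
make `(r, ν)` feasible for the LP. So there is none, and a Farkas alternative yields two constraint
types with natural multiplicities. Realised as cycles of resources, they form a game with a pure
Nash equilibrium of ratio above `1/r`.

That `ν > 0` at the optimum is a perturbation argument (`LPOptimal.pos_snd`). -/

/-! ### A uniform form of the LP constraints -/

/-- The gain in cost for the agents of a resource used by `u` agents when they switch to an
allocation in which it is used by `v` of them, the overlap being the smallest possible for `n`
agents. -/
def deviationGap (n : ℕ) (f : ℕ → ℝ) (u v : ℕ) : ℝ :=
  ((u : ℝ) - (u + v - n : ℕ)) * f u - ((v : ℝ) - (u + v - n : ℕ)) * f (u + 1)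

theorem zeroExtend_mul_self {n x : ℕ} (hx : x ≤ n) (f : ℕ → ℝ) :
    zeroExtend n f x * x = f x * x := by
  rcases Nat.eq_zero_or_pos x with rfl | h
  · simp
  · simp [zeroExtend, hx, Nat.succ_le_of_lt h]

/-- The value `f (n + 1)` never matters: `v ≥ 1` forces `u + 1 ≤ n`, and for `v = 0` its coefficient
vanishes. In the companion case `n < u + v` its coefficient is `n - u`, which is zero at `u = n`. -/
theorem deviationGap_of_add_le {n u v : ℕ} (h : u + v ≤ n) (f : ℕ → ℝ) :
    deviationGap n f u v = zeroExtend n f u * u - zeroExtend n f (u + 1) * v := by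
  rw [zeroExtend_mul_self (by omega)]
  have h0 : u + v - n = 0 := by omega
  rcases Nat.eq_zero_or_pos v with rfl | hv
  · have h1 : u - n = 0 := by omega
    simp [deviationGap, h1]; ring
  · have : u + 1 ≤ n := by omega
    simp [deviationGap, h0, zeroExtend, this]; ring

theorem deviationGap_of_lt_add {n u v : ℕ} (hu : u ≤ n) (hv : v ≤ n) (h : n < u + v) (f : ℕ → ℝ) :
    deviationGap n f u v
      = zeroExtend n f u * ((n : ℝ) - v) - zeroExtend n f (u + 1) * ((n : ℝ) - u) := by
  have h1 : ((u + v - n : ℕ) : ℝ) = u + v - n := by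
    rw [Nat.cast_sub h.le]; push_cast; ring
  have hu1 : 1 ≤ u := by omega
  rcases hu.eq_or_lt with rfl | hlt
  · simp [deviationGap, zeroExtend, hu1]; ring
  · have : u + 1 ≤ n := hlt
    simp only [deviationGap, h1, zeroExtend, hu1, hu, this, and_self, if_true,
      le_add_iff_nonneg_left, zero_le]
    ring

/-- Truncated subtraction in `deviationGap` merges the two constraint families and removes the
convention at `0` and `n + 1`. -/
theorem lpFeasible_iff {n m : ℕ} {b : Fin m → ℕ → ℝ} {ρ ν : ℝ} :
    LPFeasible n b ρ ν ↔ 0 ≤ ν ∧ ν ≤ 1 ∧ ∀ (j : Fin m) (u v : ℕ), v ≤ u → u ≤ n →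
      0 ≤ b j v * v - ρ * (b j u * u) + ν * deviationGap n (b j) u v
        + b j 1 * (1 - ν) * ((u : ℝ) - v) := by
  constructor
  · rintro ⟨h0, h1, h2, h3⟩
    refine ⟨h0, h1, fun j u v hvu hu => ?_⟩
    rcases le_or_gt (u + v) n with h | h
    · have := h2 j u v hu (hvu.trans hu) h hvu
      rwa [← deviationGap_of_add_le h, zeroExtend_mul_self (hvu.trans hu), mul_assoc ρ,
        zeroExtend_mul_self hu] at this
    · have := h3 j u v hu (hvu.trans hu) h hvu
      rwa [← deviationGap_of_lt_add hu (hvu.trans hu) h, zeroExtend_mul_self (hvu.trans hu),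
        mul_assoc ρ, zeroExtend_mul_self hu] at this
  · rintro ⟨h0, h1, h2⟩
    refine ⟨h0, h1, fun j u v hu hv h hvu => ?_, fun j u v hu hv h hvu => ?_⟩
    · rw [← deviationGap_of_add_le h, zeroExtend_mul_self hv, mul_assoc ρ,
        zeroExtend_mul_self hu]
      exact h2 j u v hvu hu
    · rw [← deviationGap_of_lt_add hu hv h, zeroExtend_mul_self hv, mul_assoc ρ,
        zeroExtend_mul_self hu]
      exact h2 j u v hvu hu

/-! ### Existence, positivity and perturbation of LP optima -/

section LinearProgram

variable {n m : ℕ} {b : Fin m → ℕ → ℝ} {ρ ν : ℝ}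

theorem LPFeasible.le_one (hn : 0 < n) (hm : 0 < m) (hpos : ∀ j x, 1 ≤ x → x ≤ n → 0 < b j x)
    (h : LPFeasible n b ρ ν) : ρ ≤ 1 := by
  -- At `u = v = n` the gap and the toll term vanish, leaving `(1 - ρ) * b n * n ≥ 0`.
  have h2 := (lpFeasible_iff.1 h).2.2 ⟨0, hm⟩ n n le_rfl le_rfl
  have hp := hpos ⟨0, hm⟩ n hn le_rfl
  have hn' : (0 : ℝ) < n := by exact_mod_cast hn
  simp only [deviationGap, Nat.add_sub_cancel, sub_self, zero_mul, mul_zero, add_zero] at h2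
  have : 0 < b ⟨0, hm⟩ n * n := by positivity
  nlinarith

/-- Without tolls proportional to the costs, every `ρ ≤ b j 1 / b j n` is feasible. -/
theorem lpFeasible_zero
    (hmono : ∀ j x y, 1 ≤ x → x ≤ y → y ≤ n → b j x ≤ b j y) (hρ : 0 ≤ ρ)
    (h : ∀ j, ρ * b j n ≤ b j 1) : LPFeasible n b ρ 0 := by
  refine lpFeasible_iff.2 ⟨le_rfl, zero_le_one, fun j u v hvu hu => ?_⟩
  rcases Nat.eq_zero_or_pos u with rfl | hu0
  · obtain rfl : v = 0 := by omega
    simp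
  · have h1 : 0 ≤ (b j 1 - ρ * b j u) * u := by
      have := hmono j u n hu0 hu le_rfl
      have := h j
      exact mul_nonneg (by nlinarith) (Nat.cast_nonneg u)
    have h2 : 0 ≤ (b j v - b j 1) * v := by
      rcases Nat.eq_zero_or_pos v with rfl | hv0
      · simp
      · have := hmono j 1 v le_rfl hv0 (hvu.trans hu)
        exact mul_nonneg (by linarith) (Nat.cast_nonneg v)
    linarith

theorem LPOptimal.pos (hn : 0 < n) (hpos : ∀ j x, 1 ≤ x → x ≤ n → 0 < b j x)
    (hmono : ∀ j x y, 1 ≤ x → x ≤ y → y ≤ n → b j x ≤ b j y) (h : LPOptimal n b ρ ν) :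
    0 < ρ := by
  have key : ∀ᶠ r in nhdsWithin (0 : ℝ) (Set.Ioi 0), ∀ j, r * b j n < b j 1 := by
    refine Filter.eventually_all.2 fun j => ?_
    refine Filter.Eventually.filter_mono nhdsWithin_le_nhds ?_
    have hc : ContinuousAt (fun r : ℝ => r * b j n) 0 := by fun_prop
    exact hc.eventually_lt continuousAt_const (by simpa using hpos j 1 le_rfl hn)
  obtain ⟨r, hr, hr0⟩ := (key.and self_mem_nhdsWithin).exists
  have hr0 : 0 < r := hr0
  exact hr0.trans_le (h.2 r 0 (lpFeasible_zero hmono hr0.le fun j => (hr j).le))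

/-- Feasible points with `ρ ≥ 0` form a compact set containing `(0, 0)`; those with `ρ < 0` cannot
compete. -/
theorem exists_lpOptimal (hn : 0 < n) (hm : 0 < m) (hpos : ∀ j x, 1 ≤ x → x ≤ n → 0 < b j x)
    (hmono : ∀ j x y, 1 ≤ x → x ≤ y → y ≤ n → b j x ≤ b j y) : ∃ ρ ν, LPOptimal n b ρ ν := by
  let S : Set (ℝ × ℝ) := {q | 0 ≤ q.1} ∩ {q | LPFeasible n b q.1 q.2}
  have hS : IsClosed S := by
    refine (isClosed_le continuous_const continuous_fst).inter ?_
    simp only [lpFeasible_iff, Set.ofPred_and, Set.ofPred_forall]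
    refine (isClosed_le continuous_const continuous_snd).inter
      ((isClosed_le continuous_snd continuous_const).inter ?_)
    refine isClosed_iInter fun j => isClosed_iInter fun u => isClosed_iInter fun v =>
      isClosed_iInter fun _ => isClosed_iInter fun _ => isClosed_le continuous_const ?_
    fun_prop
  have hsub : S ⊆ Set.Icc 0 1 ×ˢ Set.Icc 0 1 := fun q hq =>
    ⟨⟨hq.1, LPFeasible.le_one hn hm hpos hq.2⟩, hq.2.1, hq.2.2.1⟩
  have hc : IsCompact S := (isCompact_Icc.prod isCompact_Icc).of_isClosed_subset hS hsub
  have hne : S.Nonempty := ⟨(0, 0), le_refl (0 : ℝ), lpFeasible_zero hmono le_rfl fun j => by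
    simpa using (hpos j 1 le_rfl hn).le⟩
  obtain ⟨q, hq, hmax⟩ := hc.exists_isMaxOn hne continuousOn_fst
  refine ⟨q.1, q.2, hq.2, fun ρ' ν' h => ?_⟩
  rcases le_total 0 ρ' with h0 | h0
  · exact hmax (show (ρ', ν') ∈ S from ⟨h0, h⟩)
  · exact h0.trans hq.1

theorem deviationGap_eq_of_le {u v : ℕ} {f : ℕ → ℝ} (hu : u ≤ n)
    (hf : u < n → f (u + 1) = f u) : deviationGap n f u v = f u * ((u : ℝ) - v) := by
  rcases hu.eq_or_lt with rfl | h
  · simp [deviationGap]; ring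
  · rw [deviationGap, hf h]; ring

/-- Increasing `ν` from `0` relaxes all the tight constraints. -/
theorem LPOptimal.pos_snd (hn : 0 < n)
    (hpos : ∀ j x, 1 ≤ x → x ≤ n → 0 < b j x)
    (hmono : ∀ j x y, 1 ≤ x → x ≤ y → y ≤ n → b j x ≤ b j y) (hb : ∃ j, b j 1 < b j n)
    (h : LPOptimal n b ρ ν) : 0 < ν := by
  have hρ := h.pos hn hpos hmono
  have hf := lpFeasible_iff.1 h.1
  refine hf.1.lt_of_ne fun h0 => ?_
  subst h0
  have hn' : (0 : ℝ) < n := by exact_mod_cast hn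
  -- The constraint `u = n`, `v = 0` at `ν = 0`.
  have hle : ∀ j, ρ * b j n ≤ b j 1 := fun j => by
    have h1 := hf.2.2 j n 0 (Nat.zero_le _) le_rfl
    simp only [Nat.cast_zero, mul_zero, zero_mul, sub_zero, mul_one] at h1
    have : 0 ≤ (b j 1 - ρ * b j n) * n := by linarith
    linarith [nonneg_of_mul_nonneg_left this hn']
  have hρ1 : ρ < 1 := by
    obtain ⟨j, hj⟩ := hb
    have := hle j
    have := hpos j n hn le_rfl
    by_contra hcon
    nlinarith
  -- For fixed `ρ` a constraint is affine in `ν`: `c₀` is its value at `ν = 0` and `c₁` its slope.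
  let c₀ : Fin m × Fin (n + 1) × Fin (n + 1) → ℝ := fun k =>
    b k.1 k.2.2 * k.2.2.1 - ρ * (b k.1 k.2.1 * k.2.1.1) + b k.1 1 * ((k.2.1.1 : ℝ) - k.2.2.1)
  let c₁ : Fin m × Fin (n + 1) × Fin (n + 1) → ℝ := fun k =>
    deviationGap n (b k.1) k.2.1 k.2.2 - b k.1 1 * ((k.2.1.1 : ℝ) - k.2.2.1)
  have key : ∀ᶠ ε in nhdsWithin (0 : ℝ) (Set.Ioi 0), ∀ k : Fin m × Fin (n + 1) × Fin (n + 1),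
      k.2.2 ≤ k.2.1 → 0 < k.2.1.1 → 0 < c₀ k + ε * c₁ k := by
    refine Filter.eventually_all.2 fun k => ?_
    rcases k with ⟨j, ⟨u, hu⟩, ⟨v, hv⟩⟩
    by_cases hvu : v ≤ u; swap
    · exact Filter.Eventually.of_forall fun _ h => absurd h (by simpa using hvu)
    rcases Nat.eq_zero_or_pos u with rfl | hu0
    · exact Filter.Eventually.of_forall fun _ _ h => absurd h (by simp)
    have hun : u ≤ n := by omega
    have hu0' : (0 : ℝ) < u := by exact_mod_cast hu0
    have hun' := hmono j u n hu0 hun le_rfl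
    have hlej := hle j
    have h1 : 0 ≤ (b j 1 - ρ * b j u) * u := mul_nonneg (by nlinarith) hu0'.le
    have h2 : 0 ≤ (b j v - b j 1) * v := by
      rcases Nat.eq_zero_or_pos v with rfl | hv0
      · simp
      · have := hmono j 1 v le_rfl hv0 (hvu.trans hun)
        exact mul_nonneg (by linarith) (Nat.cast_nonneg v)
    have hc₀ : c₀ (j, ⟨u, hu⟩, ⟨v, hv⟩) = (b j 1 - ρ * b j u) * u + (b j v - b j 1) * v := by
      simp only [c₀]; ring
    rcases (add_nonneg h1 h2).eq_or_lt with heq | hlt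
    · have e1 : (b j 1 - ρ * b j u) * u = 0 := by linarith
      have e2 : (b j v - b j 1) * v = 0 := by linarith
      have e1' : b j 1 = ρ * b j u := by
        rcases mul_eq_zero.1 e1 with h | h
        · linarith
        · exact absurd h hu0'.ne'
      have hbu := hpos j u hu0 hun
      have hlt : b j 1 < b j u := by nlinarith
      have hun2 : b j u = b j n := le_antisymm hun' (by nlinarith)
      have hvu' : v < u := by
        refine lt_of_le_of_ne hvu ?_
        rintro rfl
        rcases mul_eq_zero.1 e2 with h | h
        · linarith
        · exact absurd h hu0'.ne'
      have hvu'' : (v : ℝ) < u := by exact_mod_cast hvu'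
      have hc₁ : 0 < c₁ (j, ⟨u, hu⟩, ⟨v, hv⟩) := by
        have : c₁ (j, ⟨u, hu⟩, ⟨v, hv⟩) = (b j u - b j 1) * ((u : ℝ) - v) := by
          simp only [c₁]
          rw [deviationGap_eq_of_le hun fun hlt' => ?_]
          · ring
          · exact le_antisymm (hun2 ▸ hmono j (u + 1) n (by omega) hlt' le_rfl)
              (hmono j u (u + 1) hu0 (by omega) hlt')
        rw [this]
        exact mul_pos (by linarith) (by linarith)
      filter_upwards [self_mem_nhdsWithin] with ε hε _ _
      rw [hc₀, ← heq, zero_add]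
      exact mul_pos hε hc₁
    · refine Filter.Eventually.filter_mono nhdsWithin_le_nhds ?_
      have hc : ContinuousAt (fun ε : ℝ => c₀ (j, ⟨u, hu⟩, ⟨v, hv⟩)
        + ε * c₁ (j, ⟨u, hu⟩, ⟨v, hv⟩)) 0 := by fun_prop
      filter_upwards [continuousAt_const.eventually_lt hc (f := fun _ => (0 : ℝ))
        (by simpa [hc₀] using hlt)] with ε hε _ _ using hε
  have hIoo : Set.Ioo (0 : ℝ) 1 ∈ nhdsWithin (0 : ℝ) (Set.Ioi 0) := Ioo_mem_nhdsGT zero_lt_one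
  obtain ⟨ε, hε, hε0, hε1⟩ := (key.and hIoo).exists
  -- At `ν = ε` the finitely many constraints with `u > 0` are strict, so `ρ` can be raised, against
  -- optimality.
  have key2 : ∀ᶠ δ in nhdsWithin (0 : ℝ) (Set.Ioi 0), ∀ k : Fin m × Fin (n + 1) × Fin (n + 1),
      k.2.2 ≤ k.2.1 → 0 < k.2.1.1 →
        δ * (b k.1 k.2.1 * k.2.1.1) < c₀ k + ε * c₁ k := by
    refine Filter.eventually_all.2 fun k => ?_
    refine Filter.eventually_imp_distrib_left.2 fun hk =>
      Filter.eventually_imp_distrib_left.2 fun hk0 => ?_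
    refine Filter.Eventually.filter_mono nhdsWithin_le_nhds ?_
    have hc : ContinuousAt (fun δ : ℝ => δ * (b k.1 k.2.1 * k.2.1.1)) 0 := by fun_prop
    exact hc.eventually_lt continuousAt_const (by simpa using hε k hk hk0)
  obtain ⟨δ, hδ, hδ0⟩ := (key2.and self_mem_nhdsWithin).exists
  have hδ0 : 0 < δ := hδ0
  have hfeas : LPFeasible n b (ρ + δ) ε := by
    refine lpFeasible_iff.2 ⟨hε0.le, hε1.le, fun j u v hvu hu => ?_⟩
    rcases Nat.eq_zero_or_pos u with rfl | hu0
    · obtain rfl : v = 0 := by omega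
      simp [deviationGap]
    · have := hδ (j, ⟨u, by omega⟩, ⟨v, by omega⟩) (by simpa using hvu) hu0
      simp only [c₀, c₁] at this
      linarith
  linarith [h.2 _ _ hfeas]

theorem lpOptimal_one_of_const (hn : 0 < n) (hm : 0 < m)
    (hpos : ∀ j x, 1 ≤ x → x ≤ n → 0 < b j x)
    (hmono : ∀ j x y, 1 ≤ x → x ≤ y → y ≤ n → b j x ≤ b j y) (hb : ∀ j, b j n ≤ b j 1) :
    LPOptimal n b 1 1 := by
  have hc : ∀ j x, 1 ≤ x → x ≤ n → b j x = b j 1 := fun j x h1 h2 =>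
    le_antisymm ((hmono j x n h1 h2 le_rfl).trans (hb j)) (hmono j 1 x le_rfl h1 h2)
  refine ⟨lpFeasible_iff.2 ⟨zero_le_one, le_rfl, fun j u v hvu hu => ?_⟩,
    fun ρ' ν' h => h.le_one hn hm hpos⟩
  rcases Nat.eq_zero_or_pos u with rfl | hu0
  · obtain rfl : v = 0 := by omega
    simp [deviationGap]
  · rw [deviationGap_eq_of_le hu fun h => (hc j _ (by omega) h).trans (hc j u hu0 hu).symm,
      hc j u hu0 hu]
    rcases Nat.eq_zero_or_pos v with rfl | hv0
    · simp
    · rw [hc j v hv0 (hvu.trans hu)]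
      apply le_of_eq; ring

theorem exists_lpOptimal_pos (hn : 0 < n) (hm : 0 < m)
    (hpos : ∀ j x, 1 ≤ x → x ≤ n → 0 < b j x)
    (hmono : ∀ j x y, 1 ≤ x → x ≤ y → y ≤ n → b j x ≤ b j y) :
    ∃ ρ ν, LPOptimal n b ρ ν ∧ 0 < ν := by
  by_cases hb : ∃ j, b j 1 < b j n
  · obtain ⟨ρ, ν, h⟩ := exists_lpOptimal hn hm hpos hmono
    exact ⟨ρ, ν, h, h.pos_snd hn hpos hmono hb⟩
  · push Not at hb
    exact ⟨1, 1, lpOptimal_one_of_const hn hm hpos hmono hb, one_pos⟩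

end LinearProgram

/-! ### Farkas alternative -/

/-- A Farkas alternative in one variable with natural multipliers. -/
theorem exists_multiplier_or_exists_nat_combination {ι : Type*} [Finite ι] (A B : ι → ℝ) :
    (∃ ν, 0 ≤ ν ∧ ∀ k, 0 ≤ A k + ν * B k) ∨
      ∃ (k l : ι) (p q : ℕ), p * B k + q * B l ≤ 0 ∧ p * A k + q * A l < 0 := by
  by_contra! hcon
  obtain ⟨h1, h2⟩ := hcon
  have hsingle : ∀ k, B k ≤ 0 → 0 ≤ A k := fun k hk => by
    simpa using h2 k k 1 0 (by simpa using hk)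
  have hpair : ∀ k l, 0 < B k → B l < 0 → A k < 0 → 0 ≤ A k * -B l + A l * B k := by
    intro k l hk hl hAk
    by_contra! hlt
    have hAl := hsingle l hl.le
    have hlt' : A l / -A k < -B l / B k := by
      rw [div_lt_div_iff₀ (by linarith) hk]; nlinarith
    -- The violated inequality is strict, so the ratio of the multipliers may be taken rational;
    -- clearing its denominator gives natural ones.
    obtain ⟨r, hr1, hr2⟩ := exists_rat_btwn hlt'
    have hr0 : (0 : ℝ) ≤ r := (div_nonneg hAl (by linarith)).trans hr1.le
    have hr0' : (0 : ℚ) ≤ r := by exact_mod_cast hr0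
    have hd : (0 : ℝ) < r.den := by exact_mod_cast r.den_pos
    have hnum : ((r.num.toNat : ℕ) : ℝ) = r * r.den := by
      have e : ((r.num.toNat : ℕ) : ℤ) = r.num := Int.toNat_of_nonneg (Rat.num_nonneg.2 hr0')
      have : ((r.num.toNat : ℕ) : ℚ) = r * r.den := by
        rw [Rat.mul_den_eq_num]; exact_mod_cast e
      exact_mod_cast this
    rw [div_lt_iff₀ (by linarith)] at hr1
    rw [lt_div_iff₀ hk] at hr2
    have := h2 k l r.num.toNat r.den (by rw [hnum]; nlinarith)
    rw [hnum] at this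
    nlinarith
  cases nonempty_fintype ι
  -- The candidate `ν` is the least one meeting `0` and every lower bound coming from `B k > 0`. A
  -- constraint `l` violated there has `B l < 0`, and pairing it with the maximizing `k` contradicts
  -- `hpair`.
  let s : Finset ℝ := insert 0 ((Finset.univ.filter fun k => 0 < B k).image fun k => -A k / B k)
  have hs : s.Nonempty := ⟨0, Finset.mem_insert_self _ _⟩
  have hs0 : 0 ≤ s.max' hs := Finset.le_max' s 0 (Finset.mem_insert_self _ _)
  obtain ⟨l, hl⟩ := h1 (s.max' hs) hs0
  rcases lt_trichotomy (B l) 0 with hB | hB | hB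
  · have hAl := hsingle l hB.le
    rcases Finset.mem_insert.1 (s.max'_mem hs) with h | h
    · rw [h] at hl; linarith
    · obtain ⟨k, hk, hk'⟩ := Finset.mem_image.1 h
      rw [← hk'] at hl hs0
      have hBk : 0 < B k := (Finset.mem_filter.1 hk).2
      have hAk : A k < 0 := by
        by_contra! hAk
        have : -A k / B k ≤ 0 := div_nonpos_of_nonpos_of_nonneg (by linarith) hBk.le
        have e : -A k / B k = 0 := le_antisymm this hs0
        rw [e] at hl; linarith
      have := hpair k l hBk hB hAk
      have e : (A l + -A k / B k * B l) * B k = A k * -B l + A l * B k := by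
        field_simp; ring
      nlinarith
  · have := hsingle l hB.le
    rw [hB] at hl; linarith
  · have : -A l / B l ≤ s.max' hs := Finset.le_max' s _ (Finset.mem_insert_of_mem
      (Finset.mem_image.2 ⟨l, by simpa using hB, rfl⟩))
    rw [div_le_iff₀ hB] at this
    linarith

/-! ### Costs and deviations counted resource by resource -/

namespace CongestionGame

variable {n : ℕ} {L : Set (ℕ → ℝ)} (G : CongestionGame n L)

/-- The number of agents using the resource `e` in both allocations. -/
def overlap (a a' : G.Allocation) (e : G.Resource) : ℕ :=
  (Finset.univ.filter fun i => e ∈ (a i).1 ∧ e ∈ (a' i).1).card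

theorem load_le (a : G.Allocation) (e : G.Resource) : G.load a e ≤ n :=
  (Finset.card_le_univ _).trans (by simpa using G.numAgents_le)

theorem overlap_le_left (a a' : G.Allocation) (e : G.Resource) :
    G.overlap a a' e ≤ G.load a e :=
  Finset.card_le_card (Finset.monotone_filter_right _ fun _ _ h => h.1)

theorem overlap_le_right (a a' : G.Allocation) (e : G.Resource) :
    G.overlap a a' e ≤ G.load a' e :=
  Finset.card_le_card (Finset.monotone_filter_right _ fun _ _ h => h.2)

theorem load_add_load_le (a a' : G.Allocation) (e : G.Resource) :
    G.load a e + G.load a' e ≤ n + G.overlap a a' e := by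
  have h := Finset.card_union_add_card_inter (Finset.univ.filter fun i => e ∈ (a i).1)
    (Finset.univ.filter fun i => e ∈ (a' i).1)
  rw [← Finset.filter_and] at h
  have h' := Finset.card_le_univ ((Finset.univ.filter fun i => e ∈ (a i).1) ∪
    (Finset.univ.filter fun i => e ∈ (a' i).1))
  rw [Fintype.card_fin] at h'
  have := G.numAgents_le
  unfold load overlap
  omega

theorem load_update (a : G.Allocation) (i : Fin G.numAgents)
    (A : {A : Finset G.Resource // A ∈ G.actions i}) {e : G.Resource} (he : e ∈ A.1) :
    G.load (Function.update a i A) e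
      = if e ∈ (a i).1 then G.load a e else G.load a e + 1 := by
  have h : (Finset.univ.filter fun k => e ∈ (Function.update a i A k).1)
      = insert i (Finset.univ.filter fun k => e ∈ (a k).1) := by
    ext k
    by_cases hk : k = i
    · subst hk; simp [he]
    · simp [hk]
  unfold load
  rw [h]
  split_ifs with hi
  · rw [Finset.insert_eq_of_mem (by simpa using hi)]
  · rw [Finset.card_insert_of_notMem (by simpa using hi)]

theorem sum_agents_eq_sum_load (a : G.Allocation) (f : G.Resource → ℝ) :
    ∑ i, ∑ e ∈ (a i).1, f e = ∑ e, G.load a e * f e := by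
  have : ∀ i, ∑ e ∈ (a i).1, f e = ∑ e, if e ∈ (a i).1 then f e else 0 := fun i => by simp
  simp_rw [this]
  rw [Finset.sum_comm]
  refine Finset.sum_congr rfl fun e _ => ?_
  rw [← Finset.sum_filter, Finset.sum_const, nsmul_eq_mul, load]

theorem systemCost_eq (a : G.Allocation) :
    G.systemCost a = ∑ e, G.load a e * G.cost e (G.load a e) :=
  G.sum_agents_eq_sum_load a fun e => G.cost e (G.load a e)

theorem systemCost_nonneg (hL : ∀ ℓ ∈ L, ∀ x, 1 ≤ x → x ≤ n → 0 ≤ ℓ x) (a : G.Allocation) :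
    0 ≤ G.systemCost a := by
  rw [systemCost_eq]
  refine Finset.sum_nonneg fun e _ => ?_
  rcases Nat.eq_zero_or_pos (G.load a e) with h | h
  · simp [h]
  · exact mul_nonneg (Nat.cast_nonneg _) (hL _ (G.cost_mem e) _ h (G.load_le a e))

theorem sum_agentCost_eq (T : LocalMechanism) (a : G.Allocation) :
    ∑ i, G.agentCost T a i
      = ∑ e, G.load a e * (G.cost e (G.load a e) + T (G.cost e) (G.load a e)) :=
  G.sum_agents_eq_sum_load a fun e => G.cost e (G.load a e) + T (G.cost e) (G.load a e)

theorem agentCost_update (T : LocalMechanism) (a : G.Allocation) (i : Fin G.numAgents)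
    (A : {A : Finset G.Resource // A ∈ G.actions i}) :
    G.agentCost T (Function.update a i A) i = ∑ e ∈ A.1, if e ∈ (a i).1
      then G.cost e (G.load a e) + T (G.cost e) (G.load a e)
      else G.cost e (G.load a e + 1) + T (G.cost e) (G.load a e + 1) := by
  unfold agentCost
  rw [Function.update_self]
  refine Finset.sum_congr rfl fun e he => ?_
  rw [load_update G a i A he]
  split_ifs <;> rfl

/-- An agent already on `e` leaves its load unchanged, while a newcomer raises it by one; hence only
the two loads and the overlap matter. -/
theorem sum_agentCost_update_eq (T : LocalMechanism) (a a' : G.Allocation) :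
    ∑ i, G.agentCost T (Function.update a i (a' i)) i
      = ∑ e, (G.overlap a a' e * (G.cost e (G.load a e) + T (G.cost e) (G.load a e))
        + ((G.load a' e : ℝ) - G.overlap a a' e)
          * (G.cost e (G.load a e + 1) + T (G.cost e) (G.load a e + 1))) := by
  have : ∀ i, G.agentCost T (Function.update a i (a' i)) i
      = ∑ e ∈ (a' i).1, (G.cost e (G.load a e + 1) + T (G.cost e) (G.load a e + 1))
        + ∑ e, if e ∈ (a i).1 ∧ e ∈ (a' i).1
          then (G.cost e (G.load a e) + T (G.cost e) (G.load a e))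
            - (G.cost e (G.load a e + 1) + T (G.cost e) (G.load a e + 1)) else 0 := fun i => by
    rw [agentCost_update]
    have h : ∀ (s : Finset G.Resource) (f : G.Resource → ℝ),
        ∑ e ∈ s, f e = ∑ e, if e ∈ s then f e else 0 := fun s f => by simp
    rw [h (a' i).1, h (a' i).1, ← Finset.sum_add_distrib]
    refine Finset.sum_congr rfl fun e _ => ?_
    by_cases h1 : e ∈ (a i).1 <;> by_cases h2 : e ∈ (a' i).1 <;> simp [h1, h2]
  simp_rw [this]
  rw [Finset.sum_add_distrib, sum_agents_eq_sum_load, Finset.sum_comm, ← Finset.sum_add_distrib]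
  refine Finset.sum_congr rfl fun e _ => ?_
  rw [← Finset.sum_filter, Finset.sum_const, nsmul_eq_mul, ← overlap]
  ring

instance : Nonempty G.Allocation := ⟨fun i => ⟨_, (G.actions_nonempty i).choose_spec⟩⟩

theorem nashCost_le_coarseCost (T : LocalMechanism) : G.nashCost T ≤ G.coarseCost T := by
  classical
  refine iSup₂_le fun a ha => ?_
  have hs : ∀ f : G.Allocation → ℝ, ∑ x, (Pi.single a 1 : G.Allocation → ℝ) x * f x = f a :=
    fun f => by simp [Pi.single_apply]
  have hp : G.IsCoarseCorrelated T (Pi.single a 1) :=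
    ⟨single_mem_stdSimplex ℝ a, fun i A => by
      rw [hs fun x => G.agentCost T x i, hs fun x => G.agentCost T (Function.update x i A) i]
      exact ha i A⟩
  refine le_trans (le_of_eq ?_) (le_iSup₂ (f := fun (p : G.Allocation → ℝ)
    (_ : G.IsCoarseCorrelated T p) => ENNReal.ofReal (∑ a, p a * G.systemCost a)) _ hp)
  rw [hs]

end CongestionGame

theorem pureNashPoA_le_coarsePoA (n : ℕ) (L : Set (ℕ → ℝ)) (T : LocalMechanism) :
    pureNashPoA n L T ≤ coarsePoA n L T :=
  iSup_mono fun G => ENNReal.div_le_div_right (G.nashCost_le_coarseCost T) _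

theorem nonneg_of_mem_costClass {n m : ℕ} {b : Fin m → ℕ → ℝ}
    (hpos : ∀ j x, 1 ≤ x → x ≤ n → 0 < b j x) {ℓ : ℕ → ℝ} (hℓ : ℓ ∈ costClass b) {x : ℕ}
    (h1 : 1 ≤ x) (hx : x ≤ n) : 0 ≤ ℓ x := by
  obtain ⟨α, hα, rfl⟩ := hℓ
  exact Finset.sum_nonneg fun j _ => mul_nonneg (hα j) (hpos j x h1 hx).le

/-! ### Smoothness and the upper bound -/

section Smoothness

variable {n m : ℕ} {b : Fin m → ℕ → ℝ} {ρ ν : ℝ}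

/-- The constraints of the linear program give the smoothness inequality for all pairs of loads
`x`, `y` and all possible overlaps `z`. -/
theorem LPFeasible.basis_smooth (hn : 0 < n) (hm : 0 < m)
    (hpos : ∀ j x, 1 ≤ x → x ≤ n → 0 < b j x)
    (hmono : ∀ j x y, 1 ≤ x → x ≤ y → y ≤ n → b j x ≤ b j y) (h : LPFeasible n b ρ ν)
    (j : Fin m) {x y z : ℕ} (hx : x ≤ n) (hy : y ≤ n) (hzx : z ≤ x) (hzy : z ≤ y)
    (hz : x + y ≤ n + z) :
    0 ≤ b j y * y - ρ * (b j x * x)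
      + ν * (((x : ℝ) - z) * b j x - ((y : ℝ) - z) * b j (x + 1))
      + b j 1 * (1 - ν) * ((x : ℝ) - y) := by
  have hρ := h.le_one hn hm hpos
  obtain ⟨h0, h1, h2⟩ := lpFeasible_iff.1 h
  have hzx' : (z : ℝ) ≤ x := by exact_mod_cast hzx
  rcases le_or_gt y x with hyx | hxy
  · have h3 := h2 j x y hyx hx
    -- The right side has slope `b j (x + 1) - b j x ≥ 0` in `z`, so the minimal overlap is the
    -- worst. At `x = n` the overlap is forced to be `y`, and `b j (n + 1)` drops out.
    suffices hs : deviationGap n (b j) x y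
        ≤ ((x : ℝ) - z) * b j x - ((y : ℝ) - z) * b j (x + 1) by
      have := mul_le_mul_of_nonneg_left hs h0
      linarith
    have hz0 : ((x + y - n : ℕ) : ℝ) ≤ z := by
      exact_mod_cast (by omega : x + y - n ≤ z)
    rcases hx.eq_or_lt with rfl | hlt
    · obtain rfl : y = z := by omega
      simp [deviationGap]
    · rcases Nat.eq_zero_or_pos x with rfl | hx0
      · obtain rfl : z = 0 := by omega
        obtain rfl : y = 0 := by omega
        simp [deviationGap]
      · have := hmono j x (x + 1) hx0 (by omega) hlt
        unfold deviationGap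
        nlinarith
  -- For `x < y` the LP has no constraint; the expression is exactly the sum of the non-negative
  -- terms `h5`, `h6`, `h7`, `h8`.
  · have hxy' : (x : ℝ) + 1 ≤ y := by exact_mod_cast hxy
    have h3 := hmono j (x + 1) y (by omega) hxy hy
    have h4 := hmono j 1 (x + 1) le_rfl (by omega) (by omega)
    have h5 : 0 ≤ ((x : ℝ) - ν * (x - z)) * (b j (x + 1) - b j x) := by
      rcases Nat.eq_zero_or_pos x with rfl | hx0
      · obtain rfl : z = 0 := by omega
        simp
      · have := hmono j x (x + 1) hx0 (by omega) (by omega)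
        refine mul_nonneg ?_ (by linarith)
        have hz0 : (0 : ℝ) ≤ z := Nat.cast_nonneg z
        nlinarith
    have h6 : 0 ≤ (1 - ρ) * (b j x * x) := by
      rcases Nat.eq_zero_or_pos x with rfl | hx0
      · simp
      · have := hpos j x hx0 hx
        have : 0 ≤ 1 - ρ := by linarith
        positivity
    have h7 : 0 ≤ ((y : ℝ) - x) * ((1 - ν) * (b j (x + 1) - b j 1)) :=
      mul_nonneg (by linarith) (mul_nonneg (by linarith) (by linarith))
    have h8 : 0 ≤ (y : ℝ) * (b j y - b j (x + 1)) :=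
      mul_nonneg (Nat.cast_nonneg y) (by linarith)
    linarith

theorem LPFeasible.smooth (hn : 0 < n) (hm : 0 < m)
    (hpos : ∀ j x, 1 ≤ x → x ≤ n → 0 < b j x)
    (hmono : ∀ j x y, 1 ≤ x → x ≤ y → y ≤ n → b j x ≤ b j y) (h : LPFeasible n b ρ ν)
    {ℓ : ℕ → ℝ} (hℓ : ℓ ∈ costClass b) {x y z : ℕ} (hx : x ≤ n) (hy : y ≤ n) (hzx : z ≤ x)
    (hzy : z ≤ y) (hz : x + y ≤ n + z) :
    0 ≤ ℓ y * y - ρ * (ℓ x * x)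
      + ν * (((x : ℝ) - z) * ℓ x - ((y : ℝ) - z) * ℓ (x + 1))
      + ℓ 1 * (1 - ν) * ((x : ℝ) - y) := by
  obtain ⟨α, hα, rfl⟩ := hℓ
  have key := Finset.sum_nonneg fun j (_ : j ∈ Finset.univ) => mul_nonneg (hα j)
    (h.basis_smooth hn hm hpos hmono j hx hy hzx hzy hz)
  refine key.trans_eq ?_
  simp only [Finset.sum_mul, Finset.mul_sum, ← Finset.sum_sub_distrib,
    ← Finset.sum_add_distrib]
  refine Finset.sum_congr rfl fun j _ => ?_
  ring

/-- Multiplication by `ν` turns the toll into `(1 - ν) * ℓ 1`. Being constant in the load, it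
cancels on the overlap and leaves the factor `x - y`. -/
theorem LPFeasible.systemCost_smooth (hn : 0 < n) (hm : 0 < m)
    (hpos : ∀ j x, 1 ≤ x → x ≤ n → 0 < b j x)
    (hmono : ∀ j x y, 1 ≤ x → x ≤ y → y ≤ n → b j x ≤ b j y) (h : LPFeasible n b ρ ν)
    (hν : 0 < ν) (G : CongestionGame n (costClass b)) (a a' : G.Allocation) :
    0 ≤ G.systemCost a' - ρ * G.systemCost a
      + ν * ∑ i, (G.agentCost (congestionIndependent fun ℓ => (1 / ν - 1) * ℓ 1) a i
        - G.agentCost (congestionIndependent fun ℓ => (1 / ν - 1) * ℓ 1)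
          (Function.update a i (a' i)) i) := by
  rw [Finset.sum_sub_distrib, G.sum_agentCost_eq, G.sum_agentCost_update_eq, G.systemCost_eq,
    G.systemCost_eq, Finset.mul_sum, ← Finset.sum_sub_distrib, ← Finset.sum_sub_distrib,
    Finset.mul_sum, ← Finset.sum_add_distrib]
  refine Finset.sum_nonneg fun e _ => ?_
  refine (h.smooth hn hm hpos hmono (G.cost_mem e) (G.load_le a e) (G.load_le a' e)
    (G.overlap_le_left a a' e) (G.overlap_le_right a a' e)
    (G.load_add_load_le a a' e)).trans_eq ?_
  simp only [congestionIndependent]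
  field_simp
  ring

theorem LPFeasible.coarsePoA_le (hn : 0 < n) (hm : 0 < m)
    (hpos : ∀ j x, 1 ≤ x → x ≤ n → 0 < b j x)
    (hmono : ∀ j x y, 1 ≤ x → x ≤ y → y ≤ n → b j x ≤ b j y) (h : LPFeasible n b ρ ν)
    (hρ : 0 < ρ) (hν : 0 < ν) :
    coarsePoA n (costClass b) (congestionIndependent fun ℓ => (1 / ν - 1) * ℓ 1)
      ≤ ENNReal.ofReal (1 / ρ) := by
  refine iSup_le fun G => ENNReal.div_le_of_le_mul (iSup₂_le fun p hp => ?_)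
  obtain ⟨a', ha'⟩ := exists_eq_ciInf_of_finite
    (f := fun a : G.Allocation => ENNReal.ofReal (G.systemCost a))
  rw [CongestionGame.minCost, ← ha', ← ENNReal.ofReal_mul (by positivity)]
  refine ENNReal.ofReal_le_ofReal ?_
  rw [one_div, ← div_eq_inv_mul, le_div_iff₀ hρ]
  set T : LocalMechanism := congestionIndependent fun ℓ => (1 / ν - 1) * ℓ 1
  have h1 : 0 ≤ ∑ a, p a * (G.systemCost a' - ρ * G.systemCost a
      + ν * ∑ i, (G.agentCost T a i - G.agentCost T (Function.update a i (a' i)) i)) :=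
    Finset.sum_nonneg fun a _ => mul_nonneg (hp.1.1 a)
      (h.systemCost_smooth hn hm hpos hmono hν G a a')
  have h2 : ∑ a, p a * (G.systemCost a' - ρ * G.systemCost a
      + ν * ∑ i, (G.agentCost T a i - G.agentCost T (Function.update a i (a' i)) i))
      = G.systemCost a' - ρ * ∑ a, p a * G.systemCost a
        + ν * ∑ i, (∑ a, p a * G.agentCost T a i
          - ∑ a, p a * G.agentCost T (Function.update a i (a' i)) i) := by
    have h3 : ∑ a, p a * G.systemCost a' = G.systemCost a' := by
      rw [← Finset.sum_mul, hp.1.2, one_mul]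
    simp_rw [← Finset.sum_sub_distrib]
    rw [Finset.sum_comm]
    conv_rhs => rw [← h3]
    simp_rw [Finset.mul_sum, ← Finset.sum_sub_distrib, ← Finset.sum_add_distrib]
    refine Finset.sum_congr rfl fun a _ => ?_
    rw [mul_add, Finset.mul_sum]
    congr 1
    · ring
    · exact Finset.sum_congr rfl fun i _ => by ring
  have h3 : ∑ i, (∑ a, p a * G.agentCost T a i
      - ∑ a, p a * G.agentCost T (Function.update a i (a' i)) i) ≤ 0 :=
    Finset.sum_nonpos fun i _ => sub_nonpos.2 (hp.2 i (a' i))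
  have := mul_nonpos_of_nonneg_of_nonpos hν.le h3
  linarith

end Smoothness

/-! ### The cyclic game -/

theorem card_filter_fin_Ico {n : ℕ} (a : ℕ) {c : ℕ} (hc : c ≤ n) :
    (Finset.univ.filter fun s : Fin n => a ≤ s.1 ∧ s.1 < c).card = c - a := by
  rw [← Nat.card_Ico, ← Finset.card_map Fin.valEmbedding]
  congr 1
  ext x
  simp only [Finset.mem_map, Finset.mem_filter, Finset.mem_univ, true_and,
    Fin.valEmbedding_apply, Finset.mem_Ico]
  exact ⟨by rintro ⟨s, hs, rfl⟩; exact hs, fun hx => ⟨⟨x, by omega⟩, hx, rfl⟩⟩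

section CyclicGame

variable {n : ℕ} [NeZero n] {L : Set (ℕ → ℝ)} {K : Type} [Fintype K]

/-- The resources that agent `i` uses in the equilibrium of the cyclic game: `u k` consecutive
ones on the cycle of type `k`, starting at position `i`. -/
def cyclicEquilibrium (u : K → ℕ) (i : Fin n) : Finset (K × Fin n) :=
  Finset.univ.filter fun e => (e.2 - i).1 < u e.1

/-- The resources that agent `i` uses in the optimum of the cyclic game: `v k` consecutive ones
on the cycle of type `k`, ending just before position `i`. -/
def cyclicOptimum (v : K → ℕ) (i : Fin n) : Finset (K × Fin n) :=
  Finset.univ.filter fun e => n ≤ (e.2 - i).1 + v e.1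

theorem sum_cyclicEquilibrium (u : K → ℕ) (hu : ∀ k, u k ≤ n) (i : Fin n) (g : K → ℝ) :
    ∑ e ∈ cyclicEquilibrium u i, g e.1 = ∑ k, u k * g k := by
  rw [cyclicEquilibrium, Finset.sum_filter, Fintype.sum_prod_type]
  refine Finset.sum_congr rfl fun k _ => ?_
  dsimp only
  rw [← Finset.sum_filter, Finset.sum_const, nsmul_eq_mul]
  congr 2
  have h : (Finset.univ.filter fun r : Fin n => (r - i).1 < u k).card
      = (Finset.univ.filter fun s : Fin n => 0 ≤ s.1 ∧ s.1 < u k).card :=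
    Finset.card_equiv (Equiv.subRight i) fun r => by simp
  exact h.trans (card_filter_fin_Ico 0 (hu k))

variable [DecidableEq K]

/-- The game in which every agent chooses between an equilibrium arc and an optimal arc on
each of the cycles. -/
def cyclicGame (f : K → ℕ → ℝ) (hf : ∀ k, f k ∈ L) (u v : K → ℕ) : CongestionGame n L where
  numAgents := n
  numAgents_le := le_rfl
  Resource := K × Fin n
  cost e := f e.1
  cost_mem e := hf e.1
  actions i := {cyclicEquilibrium u i, cyclicOptimum v i}
  actions_nonempty i := ⟨cyclicEquilibrium u i, by simp⟩

variable (f : K → ℕ → ℝ) (hf : ∀ k, f k ∈ L) (u v : K → ℕ)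

/-- The allocation of equilibrium arcs. -/
def cyclicGameNash : (cyclicGame (n := n) f hf u v).Allocation :=
  fun i => ⟨cyclicEquilibrium u i, Finset.mem_insert_self _ _⟩

/-- The allocation of optimal arcs. -/
def cyclicGameOpt : (cyclicGame (n := n) f hf u v).Allocation :=
  fun i => ⟨cyclicOptimum v i, Finset.mem_insert_of_mem (Finset.mem_singleton_self _)⟩

theorem load_cyclicGameNash (hu : ∀ k, u k ≤ n) (e : K × Fin n) :
    (cyclicGame (n := n) f hf u v).load (cyclicGameNash f hf u v) e = u e.1 := by
  have h : (Finset.univ.filter fun i : Fin n => e ∈ cyclicEquilibrium u i).card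
      = (Finset.univ.filter fun s : Fin n => 0 ≤ s.1 ∧ s.1 < u e.1).card := by
    refine Finset.card_equiv (Equiv.subLeft e.2) fun i => ?_
    simp [cyclicEquilibrium]
  exact h.trans (card_filter_fin_Ico 0 (hu e.1))

theorem load_cyclicGameOpt (hv : ∀ k, v k ≤ n) (e : K × Fin n) :
    (cyclicGame (n := n) f hf u v).load (cyclicGameOpt f hf u v) e = v e.1 := by
  have h : (Finset.univ.filter fun i : Fin n => e ∈ cyclicOptimum v i).card
      = (Finset.univ.filter fun s : Fin n => n - v e.1 ≤ s.1 ∧ s.1 < n).card := by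
    refine Finset.card_equiv (Equiv.subLeft e.2) fun i => ?_
    simp [cyclicOptimum]
  refine h.trans ((card_filter_fin_Ico _ le_rfl).trans ?_)
  have := hv e.1
  omega

theorem systemCost_cyclicGameNash (hu : ∀ k, u k ≤ n) :
    (cyclicGame (n := n) f hf u v).systemCost (cyclicGameNash f hf u v)
      = n * ∑ k, f k (u k) * u k := by
  rw [CongestionGame.systemCost_eq]
  refine (Finset.sum_congr rfl fun e _ => by
    rw [load_cyclicGameNash f hf u v hu e]).trans ?_
  refine (Fintype.sum_prod_type (fun e : K × Fin n => (u e.1 : ℝ) * f e.1 (u e.1))).trans ?_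
  simp only [Finset.sum_const, Finset.card_univ, Fintype.card_fin, nsmul_eq_mul, Finset.mul_sum]
  exact Finset.sum_congr rfl fun k _ => by ring

theorem systemCost_cyclicGameOpt (hv : ∀ k, v k ≤ n) :
    (cyclicGame (n := n) f hf u v).systemCost (cyclicGameOpt f hf u v)
      = n * ∑ k, f k (v k) * v k := by
  rw [CongestionGame.systemCost_eq]
  refine (Finset.sum_congr rfl fun e _ => by
    rw [load_cyclicGameOpt f hf u v hv e]).trans ?_
  refine (Fintype.sum_prod_type (fun e : K × Fin n => (v e.1 : ℝ) * f e.1 (v e.1))).trans ?_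
  simp only [Finset.sum_const, Finset.card_univ, Fintype.card_fin, nsmul_eq_mul, Finset.mul_sum]
  exact Finset.sum_congr rfl fun k _ => by ring

/-- The two arcs of an agent lie back to back at position `i`, so they meet only after wrapping
around the cycle, in `u k + v k - n` places: the smallest possible overlap. -/
theorem sum_cyclicOptimum (hu : ∀ k, u k ≤ n) (hv : ∀ k, v k ≤ n) (i : Fin n) (g g' : K → ℝ) :
    ∑ e ∈ cyclicOptimum v i, (if e ∈ cyclicEquilibrium u i then g e.1 else g' e.1)
      = ∑ k, (((u k + v k - n : ℕ) : ℝ) * g k + ((v k : ℝ) - (u k + v k - n : ℕ)) * g' k) := by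
  rw [cyclicOptimum, Finset.sum_filter, Fintype.sum_prod_type]
  refine Finset.sum_congr rfl fun k _ => ?_
  dsimp only
  rw [← Finset.sum_filter, Finset.sum_ite, Finset.sum_const, Finset.sum_const, nsmul_eq_mul,
    nsmul_eq_mul, Finset.filter_filter, Finset.filter_filter]
  have huk := hu k
  have hvk := hv k
  have h1 : (Finset.univ.filter fun r : Fin n =>
      n ≤ (r - i).1 + v k ∧ (k, r) ∈ cyclicEquilibrium u i).card
      = (Finset.univ.filter fun s : Fin n => n - v k ≤ s.1 ∧ s.1 < u k).card :=
    Finset.card_equiv (Equiv.subRight i) fun r => by simp [cyclicEquilibrium]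
  have h2 : (Finset.univ.filter fun r : Fin n =>
      n ≤ (r - i).1 + v k ∧ ¬ (k, r) ∈ cyclicEquilibrium u i).card
      = (Finset.univ.filter fun s : Fin n => max (n - v k) (u k) ≤ s.1 ∧ s.1 < n).card :=
    Finset.card_equiv (Equiv.subRight i) fun r => by simp [cyclicEquilibrium]
  rw [card_filter_fin_Ico _ huk] at h1
  rw [card_filter_fin_Ico _ le_rfl] at h2
  have e1 : u k - (n - v k) = u k + v k - n := by omega
  have e2 : n - max (n - v k) (u k) = v k - (u k + v k - n) := by omega
  rw [h1, h2, e1, e2, Nat.cast_sub (by omega : u k + v k - n ≤ v k)]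

/-- By rotational symmetry every agent faces the same single deviation, and the hypothesis says that
its gain is non-positive. -/
theorem isPureNash_cyclicGameNash (t : (ℕ → ℝ) → ℝ) (hu : ∀ k, u k ≤ n) (hv : ∀ k, v k ≤ n)
    (h : ∑ k, (deviationGap n (f k) (u k) (v k) + t (f k) * ((u k : ℝ) - v k)) ≤ 0) :
    (cyclicGame (n := n) f hf u v).IsPureNash (congestionIndependent t)
      (cyclicGameNash f hf u v) := by
  rintro i ⟨A, hA⟩
  rcases Finset.mem_insert.1 hA with rfl | hA'
  · refine le_of_eq ?_
    congr 1
    exact (Function.update_eq_self i (cyclicGameNash f hf u v)).symm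
  · obtain rfl := Finset.mem_singleton.1 hA'
    rw [CongestionGame.agentCost_update]
    have e1 : (cyclicGame (n := n) f hf u v).agentCost (congestionIndependent t)
        (cyclicGameNash f hf u v) i = ∑ k, u k * (f k (u k) + t (f k)) := by
      refine Eq.trans ?_ (sum_cyclicEquilibrium u hu i fun k => f k (u k) + t (f k))
      refine Finset.sum_congr rfl fun e _ => ?_
      rw [load_cyclicGameNash f hf u v hu e]
      rfl
    have e2 := sum_cyclicOptimum u v hu hv i (fun k => f k (u k) + t (f k))
      fun k => f k (u k + 1) + t (f k)
    rw [e1]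
    refine le_trans ?_ (le_of_eq (e2.symm.trans (Finset.sum_congr rfl fun e _ => ?_)))
    · rw [← sub_nonpos, ← Finset.sum_sub_distrib]
      refine le_trans (le_of_eq (Finset.sum_congr rfl fun k _ => ?_)) h
      unfold deviationGap
      ring
    · rw [load_cyclicGameNash f hf u v hu e]
      rfl

end CyclicGame

/-! ### Lower bound for arbitrary tolls -/

section LowerBound

variable {n m : ℕ} {b : Fin m → ℕ → ℝ} {ρ ν : ℝ}

theorem basis_mem_costClass (j : Fin m) : b j ∈ costClass b :=
  ⟨Pi.single j 1, fun i => by by_cases h : i = j <;> simp [h],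
    funext fun x => by simp [Pi.single_apply]⟩

/-- A multiplier for the constraints with arbitrary non-negative tolls gives a feasible point. -/
theorem lpFeasible_of_tolls (hn : 0 < n) (hm : 0 < m)
    (hpos : ∀ j x, 1 ≤ x → x ≤ n → 0 < b j x) {τ : Fin m → ℝ} (hτ : ∀ j, 0 ≤ τ j) (hν : 0 ≤ ν)
    (h : ∀ (j : Fin m) (u v : Fin (n + 1)), 0 ≤ b j v * v.1 - ρ * (b j u * u.1)
      + ν * (deviationGap n (b j) u v + τ j * ((u.1 : ℝ) - v.1))) :
    LPFeasible n b ρ ν := by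
  -- The case `u = 0`, `v = 1`, where the gap is `-b j 1`. It bounds the toll term by the LP's own
  -- whenever `u ≥ v`.
  have h1 : ∀ j, ν * τ j ≤ b j 1 * (1 - ν) := fun j => by
    have := h j 0 ⟨1, by omega⟩
    have h0 : 0 + 1 - n = 0 := by omega
    simp only [deviationGap, Fin.val_zero, h0] at this
    push_cast at this
    linarith
  have hν1 : ν ≤ 1 := by
    have h2 := h1 ⟨0, hm⟩
    have h3 := hpos ⟨0, hm⟩ 1 le_rfl hn
    have := mul_nonneg hν (hτ ⟨0, hm⟩)
    by_contra! hcon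
    nlinarith
  refine lpFeasible_iff.2 ⟨hν, hν1, fun j u v hvu hu => ?_⟩
  have h2 := h j ⟨u, by omega⟩ ⟨v, by omega⟩
  have h3 : (v : ℝ) ≤ u := by exact_mod_cast hvu
  have h4 := mul_le_mul_of_nonneg_right (h1 j) (sub_nonneg.2 h3)
  simp only at h2
  linarith

theorem LPOptimal.ofReal_le_pureNashPoA_of_lt (hn : 0 < n) (hm : 0 < m)
    (hpos : ∀ j x, 1 ≤ x → x ≤ n → 0 < b j x) (h : LPOptimal n b ρ ν) (hρ : 0 < ρ)
    {t : (ℕ → ℝ) → ℝ} (ht : ∀ ℓ ∈ costClass b, 0 ≤ t ℓ) {r : ℝ} (hr : ρ < r) :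
    ENNReal.ofReal (1 / r) ≤ pureNashPoA n (costClass b) (congestionIndependent t) := by
  have : NeZero n := ⟨hn.ne'⟩
  have hr0 : 0 < r := hρ.trans hr
  have hn' : (0 : ℝ) < n := by exact_mod_cast hn
  let A : Fin m × Fin (n + 1) × Fin (n + 1) → ℝ := fun k =>
    b k.1 k.2.2 * k.2.2.1 - r * (b k.1 k.2.1 * k.2.1.1)
  let B : Fin m × Fin (n + 1) × Fin (n + 1) → ℝ := fun k =>
    deviationGap n (b k.1) k.2.1 k.2.2 + t (b k.1) * ((k.2.1.1 : ℝ) - k.2.2.1)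
  rcases exists_multiplier_or_exists_nat_combination A B with ⟨ν', hν', hAB⟩ | ⟨k, l, p, q, hB, hA⟩
  · exact absurd (h.2 r ν' (lpFeasible_of_tolls hn hm hpos
      (fun j => ht _ (basis_mem_costClass j)) hν' fun j u v => hAB (j, u, v))) (not_le.2 hr)
  -- The natural multipliers become numbers of copies: `p` cycles of type `k` and `q` of type `l`.
  -- Copies share a cost function and hence a toll, so arbitrary maps `t` are covered.
  · let c : Fin p ⊕ Fin q → Fin m × Fin (n + 1) × Fin (n + 1) :=
      Sum.elim (fun _ => k) fun _ => l
    have hc : ∀ g : Fin m × Fin (n + 1) × Fin (n + 1) → ℝ, ∑ s, g (c s) = p * g k + q * g l :=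
      fun g => by simp [c]
    let f : Fin p ⊕ Fin q → ℕ → ℝ := fun s => b (c s).1
    let u : Fin p ⊕ Fin q → ℕ := fun s => (c s).2.1
    let v : Fin p ⊕ Fin q → ℕ := fun s => (c s).2.2
    have hf : ∀ s, f s ∈ costClass b := fun s => basis_mem_costClass _
    have hu : ∀ s, u s ≤ n := fun s => Nat.le_of_lt_succ (c s).2.1.2
    have hv : ∀ s, v s ≤ n := fun s => Nat.le_of_lt_succ (c s).2.2.2
    let G : CongestionGame n (costClass b) := cyclicGame f hf u v
    have hnash : G.IsPureNash (congestionIndependent t) (cyclicGameNash f hf u v) :=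
      isPureNash_cyclicGameNash f hf u v t hu hv (by rw [← hc B] at hB; exact hB)
    have hopt0 := G.systemCost_nonneg (fun ℓ hℓ x h1 h2 => nonneg_of_mem_costClass hpos hℓ h1 h2)
      (cyclicGameOpt f hf u v)
    have hlt : G.systemCost (cyclicGameOpt f hf u v)
        < r * G.systemCost (cyclicGameNash f hf u v) := by
      rw [← hc A, Finset.sum_sub_distrib, ← Finset.mul_sum] at hA
      simp only [G]
      rw [systemCost_cyclicGameNash f hf u v hu, systemCost_cyclicGameOpt f hf u v hv]
      have := mul_neg_of_pos_of_neg hn' hA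
      simp only [f, u, v]
      linarith
    have hnash0 : 0 < G.systemCost (cyclicGameNash f hf u v) :=
      pos_of_mul_pos_right (hopt0.trans_lt hlt) hr0.le
    refine le_trans ?_ (le_iSup (fun G : CongestionGame n (costClass b) =>
      G.nashCost (congestionIndependent t) / G.minCost) G)
    have h1 : ENNReal.ofReal (G.systemCost (cyclicGameNash f hf u v))
        ≤ G.nashCost (congestionIndependent t) :=
      le_iSup₂ (f := fun (a : G.Allocation) (_ : G.IsPureNash (congestionIndependent t) a) =>
        ENNReal.ofReal (G.systemCost a)) _ hnash
    have h2 : G.minCost ≤ ENNReal.ofReal (r * G.systemCost (cyclicGameNash f hf u v)) :=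
      (iInf_le _ (cyclicGameOpt f hf u v)).trans (ENNReal.ofReal_le_ofReal hlt.le)
    refine le_trans ?_ (ENNReal.div_le_div h1 h2)
    rw [← ENNReal.ofReal_div_of_pos (by positivity)]
    refine ENNReal.ofReal_le_ofReal (le_of_eq ?_)
    field_simp

/-- Only `r > ρ` is infeasible, so the bound at `ρ` is the limit `r ↓ ρ`. -/
theorem LPOptimal.ofReal_le_pureNashPoA (hn : 0 < n) (hm : 0 < m)
    (hpos : ∀ j x, 1 ≤ x → x ≤ n → 0 < b j x) (h : LPOptimal n b ρ ν) (hρ : 0 < ρ)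
    {t : (ℕ → ℝ) → ℝ} (ht : ∀ ℓ ∈ costClass b, 0 ≤ t ℓ) :
    ENNReal.ofReal (1 / ρ) ≤ pureNashPoA n (costClass b) (congestionIndependent t) := by
  have hc : Filter.Tendsto (fun r : ℝ => ENNReal.ofReal (1 / r)) (nhdsWithin ρ (Set.Ioi ρ))
      (nhds (ENNReal.ofReal (1 / ρ))) := by
    refine Filter.Tendsto.mono_left ?_ nhdsWithin_le_nhds
    refine (ENNReal.continuous_ofReal.tendsto _).comp ?_
    exact (continuousAt_const.div continuousAt_id hρ.ne' : ContinuousAt (fun r : ℝ => 1 / r) ρ)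
  refine le_of_tendsto hc ?_
  filter_upwards [self_mem_nhdsWithin] with r hr
  exact h.ofReal_le_pureNashPoA_of_lt hn hm hpos hρ ht hr

end LowerBound

theorem theorem3 (n m : ℕ) (hn : 0 < n) (hm : 0 < m) (b : Fin m → ℕ → ℝ)
    (hpos : ∀ j x, 1 ≤ x → x ≤ n → 0 < b j x)
    (hmono : ∀ j x y, 1 ≤ x → x ≤ y → y ≤ n → b j x ≤ b j y)
    (hconv : ∀ j, DiscreteConvex n (b j) ∨ DiscreteConvex n (fun x => b j x * x)) :
    -- the linear program has a solution with `ν > 0`, and only such solutions unless all the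
    -- basis functions are constant on `{1, …, n}`
    (∃ ρ ν : ℝ, LPOptimal n b ρ ν ∧ 0 < ν) ∧
    ((∃ j, b j 1 < b j n) → ∀ ρ ν : ℝ, LPOptimal n b ρ ν → 0 < ν) ∧
    -- every such solution yields an optimal mechanism
    ∀ ρ ν : ℝ, LPOptimal n b ρ ν → 0 < ν →
      0 < ρ ∧
      ∃ t : (ℕ → ℝ) → ℝ,
        (∀ α : Fin m → ℝ, (∀ j, 0 ≤ α j) →
          t (fun x => ∑ j, α j * b j x) = ∑ j, α j * ((1 / ν - 1) * b j 1)) ∧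
        (∀ j, 0 ≤ (1 / ν - 1) * b j 1) ∧
        (∀ ℓ ∈ costClass b, 0 ≤ t ℓ) ∧
        pureNashPoA n (costClass b) (congestionIndependent t) = ENNReal.ofReal (1 / ρ) ∧
        coarsePoA n (costClass b) (congestionIndependent t) = ENNReal.ofReal (1 / ρ) ∧
        ∀ t' : (ℕ → ℝ) → ℝ, (∀ ℓ ∈ costClass b, 0 ≤ t' ℓ) →
          pureNashPoA n (costClass b) (congestionIndependent t) ≤
            pureNashPoA n (costClass b) (congestionIndependent t') ∧
          coarsePoA n (costClass b) (congestionIndependent t) ≤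
            coarsePoA n (costClass b) (congestionIndependent t') := by
  refine ⟨exists_lpOptimal_pos hn hm hpos hmono,
    fun hb ρ ν h => h.pos_snd hn hpos hmono hb, fun ρ ν h hν => ?_⟩
  have hρ := h.pos hn hpos hmono
  have hν1 : 0 ≤ 1 / ν - 1 := by
    rw [sub_nonneg, le_div_iff₀ hν, one_mul]
    exact h.1.2.1
  have ht : ∀ ℓ ∈ costClass b, 0 ≤ (1 / ν - 1) * ℓ 1 := fun ℓ hℓ =>
    mul_nonneg hν1 (nonneg_of_mem_costClass hpos hℓ le_rfl hn)
  have hupper := h.1.coarsePoA_le hn hm hpos hmono hρ hν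
  have hlower := h.ofReal_le_pureNashPoA hn hm hpos hρ ht
  have hle := pureNashPoA_le_coarsePoA n (costClass b)
  -- Pure equilibria are coarse correlated, so `1/ρ ≤ pure ≤ coarse ≤ 1/ρ` collapses.
  have hpure := le_antisymm ((hle _).trans hupper) hlower
  have hcoarse := le_antisymm hupper (hlower.trans (hle _))
  -- This toll depends on `ℓ` only through `ℓ 1`, hence not on the chosen coefficients `α`.
  refine ⟨hρ, fun ℓ => (1 / ν - 1) * ℓ 1, fun α _ => ?_,
    fun j => mul_nonneg hν1 (hpos j 1 le_rfl hn).le, ht, hpure, hcoarse, fun t' ht' => ?_⟩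
  · simp only [Finset.mul_sum]
    exact Finset.sum_congr rfl fun j _ => by ring
  · have hlower' := h.ofReal_le_pureNashPoA hn hm hpos hρ ht'
    rw [hpure, hcoarse]
    exact ⟨hlower', hlower'.trans (hle _)⟩
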